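/- Let $V$ be the complex vector space of meromorphic functions on $\mathbb{C}$ and let $A = \frac{d}{dz} : V \to V$. A function $w \in V$ is called differentially transcendental if it satisfies no algebraic differential equation, i.e. if there is no $k \ge 0$ and no nonzero polynomial $P \in \mathbb{C}[z, y_0, \dots, y_k]$ such that $P(z, w, w', \dots, w^{(k)}) = 0$ identically. Let $n \ge 1$, let $B = [b_{ij}] \in \mathbb{C}^{n \times n}$ and $\varphi_1, \dots, \varphi_n \in V$, and consider the linear system with constant coefficients $$A(x_i) = b_{i1} x_1 + \dots + b_{in} x_n + \varphi_i, \qquad 1 \le i \le n,$$ in the unknowns $x_1, \dots, x_n \in V$. Suppose that $\varphi_j$ is the only differentially transcendental one among $\varphi_1, \dots, \varphi_n$, i.e. $\varphi_j$ is differentially transcendental and $\varphi_i$ is not for every $i \ne j$. Then for every solution $(x_1, \dots, x_n) \in V^n$ of the system, the entry $x_j$ is differentially transcendental. -/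

import Mathlib

open Filter

noncomputable section

namespace MeroSystem

/-- The functions `ℂ → ℂ` that are meromorphic at every point of `ℂ`
(the values taken at the poles are arbitrary). -/
def meromorphicSubalgebra : Subalgebra ℂ (ℂ → ℂ) where
  carrier := {f | Meromorphic f}
  mul_mem' hf hg := Meromorphic.mul hf hg
  add_mem' hf hg := Meromorphic.add hf hg
  algebraMap_mem' c := Meromorphic.const c

/-- The functions that vanish outside a closed discrete set: they all represent the meromorphic
function `0`. -/
def negligible : Ideal meromorphicSubalgebra where
  carrier := {f | (f : ℂ → ℂ) =ᶠ[codiscrete ℂ] 0}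
  zero_mem' := by
    change (0 : ℂ → ℂ) =ᶠ[codiscrete ℂ] 0
    exact EventuallyEq.refl _ _
  add_mem' {f g} hf hg := by
    change f.1 + g.1 =ᶠ[codiscrete ℂ] 0
    change (f : ℂ → ℂ) =ᶠ[codiscrete ℂ] 0 at hf
    change (g : ℂ → ℂ) =ᶠ[codiscrete ℂ] 0 at hg
    filter_upwards [hf, hg] with z h₁ h₂
    simp [h₁, h₂]
  smul_mem' c f hf := by
    change c.1 * f.1 =ᶠ[codiscrete ℂ] 0
    change (f : ℂ → ℂ) =ᶠ[codiscrete ℂ] 0 at hf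
    filter_upwards [hf] with z h
    simp [h]

/-- The space `V` of meromorphic functions on `ℂ`: two everywhere-defined representatives give the
same meromorphic function iff they agree outside a closed discrete set. It is a commutative
`ℂ`-algebra, in particular a vector space over `ℂ`. -/
abbrev MeromorphicFunction : Type := meromorphicSubalgebra ⧸ negligible

/-- The meromorphic function represented by `f`. -/
def ofFun (f : ℂ → ℂ) (hf : Meromorphic f) : MeromorphicFunction :=
  Ideal.Quotient.mk negligible ⟨f, hf⟩

theorem ofFun_eq_iff {f g : ℂ → ℂ} (hf : Meromorphic f) (hg : Meromorphic g) :
    ofFun f hf = ofFun g hg ↔ f =ᶠ[codiscrete ℂ] g := by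
  unfold ofFun
  rw [Ideal.Quotient.eq]
  change f - g =ᶠ[codiscrete ℂ] 0 ↔ _
  constructor
  · intro h
    filter_upwards [h] with z hz
    simpa [sub_eq_zero] using hz
  · intro h
    filter_upwards [h] with z hz
    simp [hz]

theorem exists_ofFun (v : MeromorphicFunction) :
    ∃ (f : ℂ → ℂ) (hf : Meromorphic f), v = ofFun f hf := by
  obtain ⟨⟨f, hf⟩, rfl⟩ := Ideal.Quotient.mk_surjective v
  exact ⟨f, hf, rfl⟩

theorem ofFun_add {f g : ℂ → ℂ} (hf : Meromorphic f) (hg : Meromorphic g) :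
    ofFun f hf + ofFun g hg = ofFun (f + g) (hf.add hg) := rfl

theorem smul_ofFun (c : ℂ) {f : ℂ → ℂ} (hf : Meromorphic f) :
    c • ofFun f hf = ofFun (c • f) (hf.const_smul c) := rfl

theorem deriv_congr {f g : ℂ → ℂ} (h : f =ᶠ[codiscrete ℂ] g) :
    deriv f =ᶠ[codiscrete ℂ] deriv g := by
  have ho : IsOpen {z | f z = g z} := (mem_codiscrete'.mp h).1
  filter_upwards [h] with z hz
  exact EventuallyEq.deriv_eq (ho.mem_nhds hz)

theorem eventually_differentiableAt {f : ℂ → ℂ} (hf : Meromorphic f) :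
    ∀ᶠ z in codiscrete ℂ, DifferentiableAt ℂ f z :=
  (MeromorphicOn.eventually_codiscreteWithin_analyticAt f
    (hf.meromorphicOn (s := Set.univ))).mono fun _ h => h.differentiableAt

/-- The operator `A = d/dz` on meromorphic functions: the class of `f` is sent to the class of the
derivative of `f`. -/
def ddz : MeromorphicFunction →ₗ[ℂ] MeromorphicFunction where
  toFun v := Quotient.liftOn' v (fun f => ofFun (deriv f.1) (Meromorphic.deriv f.2)) (by
    intro f g h
    have h' : ofFun f.1 f.2 = ofFun g.1 g.2 := Quotient.sound' h
    exact (ofFun_eq_iff _ _).2 (deriv_congr ((ofFun_eq_iff _ _).1 h')))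
  map_add' v w := by
    obtain ⟨f, hf, rfl⟩ := exists_ofFun v
    obtain ⟨g, hg, rfl⟩ := exists_ofFun w
    rw [ofFun_add]
    change ofFun (deriv (f + g)) _ = ofFun (deriv f + deriv g) (hf.deriv.add hg.deriv)
    rw [ofFun_eq_iff]
    filter_upwards [eventually_differentiableAt hf, eventually_differentiableAt hg] with z h₁ h₂
    exact deriv_add h₁ h₂
  map_smul' c v := by
    obtain ⟨f, hf, rfl⟩ := exists_ofFun v
    rw [smul_ofFun]
    change ofFun (deriv (c • f)) _ =
      ofFun (c • deriv f) (hf.deriv.const_smul c)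
    rw [ofFun_eq_iff]
    filter_upwards [eventually_differentiableAt hf] with z h₁
    exact deriv_const_smul c h₁

theorem ddz_ofFun {f : ℂ → ℂ} (hf : Meromorphic f) :
    ddz (ofFun f hf) = ofFun (deriv f) hf.deriv := rfl

/-- The identity function `z`. -/
def coordZ : MeromorphicFunction := ofFun (fun z => z) fun _ => MeromorphicAt.id _

/-- `P(z, w, w', w'', …)` for a polynomial `P` over `ℂ` in the variables `z` (index `none`) and
`y₀, y₁, y₂, …` (indices `some k`). -/
def evalADE (P : MvPolynomial (Option ℕ) ℂ) (w : MeromorphicFunction) : MeromorphicFunction :=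
  MvPolynomial.aeval
    (fun i : Option ℕ => i.elim coordZ fun k => (ddz ^ k) w) P

/-- `w` is differentially transcendental if it satisfies no algebraic differential equation
`P(z, w, w', …, w⁽ᵏ⁾) = 0` with `P` a nonzero polynomial over `ℂ`. -/
def DifferentiallyTranscendental (w : MeromorphicFunction) : Prop :=
  ¬ ∃ P : MvPolynomial (Option ℕ) ℂ, P ≠ 0 ∧ evalADE P w = 0

/-- `x` solves the linear system of first order `A`-operator equations with constant coefficients
`A(xᵢ) = bᵢ₁ x₁ + … + bᵢₙ xₙ + φᵢ`, `1 ≤ i ≤ n`. -/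
def IsSolution {K V : Type*} [Field K] [AddCommGroup V] [Module K V] {n : ℕ}
    (A : V →ₗ[K] V) (B : Matrix (Fin n) (Fin n) K) (φ x : Fin n → V) : Prop :=
  ∀ i, A (x i) = ∑ k, B i k • x k + φ i

end MeroSystem

end

/-!
An element `w` is differentially algebraic iff it is algebraic over `R[S]` for some finite set `S`
whose derivatives are again algebraic over `R[S]`: then all iterated derivatives of `w` live in an
extension of finite transcendence degree, and conversely `S` can be taken to consist of the
derivatives of `w` that precede the first one which is algebraic over its predecessors.

If `x j` were differentially algebraic, then so would be `D (x j)`. Together with the forcing terms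
`φ i`, `i ≠ j`, it can be enclosed in such a set `S`. Adding all the `x i` to `S` keeps it stable:
`D (x i)` is a polynomial in the `x k` plus `φ i` for `i ≠ j`, and `D (x j)` is already algebraic.
Hence `φ j`, the difference of `D (x j)` and a polynomial in the `x k`, would be differentially
algebraic too.
-/

section Algebraic

open Algebra Set

variable {R A ι : Type*} [CommRing R] [CommRing A] [Algebra R A]

theorem isAlgebraic_adjoin_of_mem [Nontrivial A] {S : Set A} {a : A} (ha : a ∈ adjoin R S) :
    IsAlgebraic (adjoin R S) a :=
  isAlgebraic_algebraMap (⟨a, ha⟩ : adjoin R S)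

theorem isAlgebraic_adjoin_mono [NoZeroDivisors A] {S T : Set A} (hST : S ⊆ T) {a : A}
    (ha : IsAlgebraic (adjoin R S) a) : IsAlgebraic (adjoin R T) a :=
  ha.adjoin_of_forall_isAlgebraic fun _ hs => absurd (hST hs.1) hs.2

theorem exists_isAlgebraic_adjoin_image_Iio [NoZeroDivisors A] [FaithfulSMul R A] [LinearOrder ι]
    {u : ι → A} (hu : ¬ AlgebraicIndependent R u) :
    ∃ i, IsAlgebraic (adjoin R (u '' Iio i)) (u i) := by
  classical
  by_contra! htrans
  have hfinset (t : Finset ι) : AlgebraicIndepOn R u (t : Set ι) := by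
    induction t using Finset.induction_on_max with
    | empty =>
      rw [Finset.coe_empty]
      exact algebraicIndependent_empty_type_iff.2 (FaithfulSMul.algebraMap_injective R A)
    | insert i t hlt ih =>
      rw [Finset.coe_insert]
      exact ih.insert fun halg =>
        htrans i (isAlgebraic_adjoin_mono (image_mono hlt) halg)
  refine hu (algebraicIndependent_of_finite_type fun t ht => ?_)
  simpa only [ht.coe_toFinset] using hfinset ht.toFinset

theorem not_algebraicIndependent_of_isAlgebraic_adjoin [IsDomain A] [FaithfulSMul R A]
    [Infinite ι] {S : Set A} (hS : S.Finite) {u : ι → A}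
    (hu : ∀ i, IsAlgebraic (adjoin R S) (u i)) : ¬ AlgebraicIndependent R u := by
  intro hind
  have : Nontrivial R := (algebraMap R A).domain_nontrivial
  have hsub : range u ⊆ (AlgebraicIndependent.matroid R A).closure S := by
    rw [AlgebraicIndependent.matroid_closure_eq]
    exact range_subset_iff.2 hu
  have hle : (range u).encard ≤ S.encard :=
    calc (range u).encard ≤ (AlgebraicIndependent.matroid R A).eRk
          ((AlgebraicIndependent.matroid R A).closure S) :=
        (AlgebraicIndependent.matroid_indep_iff.2 hind.coe_range).encard_le_eRk_of_subset hsub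
      _ = (AlgebraicIndependent.matroid R A).eRk S := Matroid.eRk_closure_eq ..
      _ ≤ S.encard := Matroid.eRk_le_encard ..
  exact infinite_range_of_injective hind.injective
    (encard_lt_top_iff.1 (hle.trans_lt hS.encard_lt_top))

end Algebraic

section DerivationAlgebraic

open Polynomial

variable {R B A : Type*} [CommRing R] [CommRing B] [CommRing A] [Algebra R A] [Algebra B A]

theorem isAlgebraic_derivation_aeval_sub [NoZeroDivisors B] (D : Derivation R A A)
    (hD : ∀ b : B, IsAlgebraic B (D (algebraMap B A b))) {a : A} (ha : IsAlgebraic B a)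
    (p : B[X]) :
    IsAlgebraic B (D (aeval a p) - aeval a (derivative p) * D a) := by
  induction p using Polynomial.induction_on' with
  | add p q hp hq =>
    convert hp.add hq using 1
    simp only [map_add]
    ring
  | monomial n b =>
    convert (hD b).mul (ha.pow n) using 1
    simp only [aeval_monomial, derivative_monomial, D.leibniz, D.leibniz_pow, smul_eq_mul, map_mul,
      nsmul_eq_mul, _root_.map_natCast]
    ring

section CharZero

variable [NoZeroDivisors A] [CharZero A] [FaithfulSMul B A]

theorem exists_aeval_eq_zero_aeval_derivative_ne_zero {a : A} (ha : IsAlgebraic B a) :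
    ∃ p : B[X], aeval a p = 0 ∧ aeval a (derivative p) ≠ 0 := by
  have hinj := FaithfulSMul.algebraMap_injective B A
  have : NoZeroDivisors B := hinj.noZeroDivisors _ (map_zero _) (map_mul _)
  have : CharZero B := (algebraMap B A).charZero
  obtain ⟨p, hp, hpa⟩ := ha
  induction hn : p.natDegree using Nat.strong_induction_on generalizing p with
  | _ n ih =>
    by_cases hderiv : aeval a (derivative p) = 0
    · have hdeg : p.natDegree ≠ 0 := by
        intro hconst
        rw [eq_C_of_natDegree_eq_zero hconst, aeval_C, FaithfulSMul.algebraMap_eq_zero_iff] at hpa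
        rw [eq_C_of_natDegree_eq_zero hconst, hpa, C_0] at hp
        exact hp rfl
      exact ih _ (hn ▸ natDegree_derivative_lt hdeg) (derivative p)
        (fun h => hdeg (derivative_eq_zero.1 h)) hderiv rfl
    · exact ⟨p, hpa, hderiv⟩

theorem transcendental_of_derivation_eq_one (D : Derivation B A A) {z : A} (hz : D z = 1) :
    Transcendental B z := by
  intro halg
  obtain ⟨p, hp, hp'⟩ := exists_aeval_eq_zero_aeval_derivative_ne_zero halg
  refine hp' ?_
  calc aeval z (derivative p) = D (aeval z p) := by rw [D.map_aeval, hz, smul_eq_mul, mul_one]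
    _ = 0 := by rw [hp, map_zero]

theorem isAlgebraic_derivation_apply (D : Derivation R A A)
    (hD : ∀ b : B, IsAlgebraic B (D (algebraMap B A b))) {a : A} (ha : IsAlgebraic B a) :
    IsAlgebraic B (D a) := by
  have : NoZeroDivisors B :=
    (FaithfulSMul.algebraMap_injective B A).noZeroDivisors _ (map_zero _) (map_mul _)
  obtain ⟨p, hp, hp'⟩ := exists_aeval_eq_zero_aeval_derivative_ne_zero ha
  have halg' : IsAlgebraic B (aeval a (derivative p)) :=
    Algebra.isAlgebraic_adjoin_singleton_iff.2 ha _ (aeval_mem_adjoin_singleton B a)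
  refine halg'.of_mul (mem_nonZeroDivisors_of_ne_zero hp') ?_
  simpa only [hp, map_zero, zero_sub, neg_neg] using
    (isAlgebraic_derivation_aeval_sub D hD ha p).neg

end CharZero

end DerivationAlgebraic

section Differential

open Algebra Set

variable {R A ι : Type*} [CommRing R] [CommRing A] [Algebra R A]

/-- The derivation `D` maps `S` into the algebraic closure of `R[S]`. In a domain of characteristic
zero this makes that algebraic closure stable under `D`, see
`AlgebraicallyStable.isAlgebraic_apply`. -/
def AlgebraicallyStable (D : Derivation R A A) (S : Set A) : Prop :=
  ∀ s ∈ S, IsAlgebraic (adjoin R S) (D s)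

/-- `w` is differentially algebraic over the ring of constants `R`: it satisfies an autonomous
algebraic differential equation `P(w, D w, D² w, …) = 0` with `P ≠ 0`. Admitting coefficients that
are polynomials in some `z` with `D z = 1` gives the same notion, see
`algebraicIndependent_elim_iterate_iff`. -/
def IsDifferentiallyAlgebraic (D : Derivation R A A) (w : A) : Prop :=
  ¬ AlgebraicIndependent R fun k : ℕ => D^[k] w

variable {D : Derivation R A A}

namespace AlgebraicallyStable

theorem biUnion [NoZeroDivisors A] {I : Set ι} {S : ι → Set A}
    (hS : ∀ i ∈ I, AlgebraicallyStable D (S i)) : AlgebraicallyStable D (⋃ i ∈ I, S i) := by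
  intro s hs
  obtain ⟨i, hi, hsi⟩ := mem_iUnion₂.1 hs
  exact isAlgebraic_adjoin_mono (subset_biUnion_of_mem hi) (hS i hi s hsi)

variable [IsDomain A] {S : Set A}

theorem isAlgebraic_apply_of_mem_adjoin (hS : AlgebraicallyStable D S) {a : A}
    (ha : a ∈ adjoin R S) : IsAlgebraic (adjoin R S) (D a) := by
  induction ha using adjoin_induction with
  | mem s hs => exact hS s hs
  | algebraMap r => rw [D.map_algebraMap]; exact isAlgebraic_zero
  | add a b _ _ hDa hDb => rw [map_add]; exact hDa.add hDb
  | mul a b ha hb hDa hDb =>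
    rw [D.leibniz, smul_eq_mul, smul_eq_mul]
    exact ((isAlgebraic_adjoin_of_mem ha).mul hDb).add ((isAlgebraic_adjoin_of_mem hb).mul hDa)

theorem isAlgebraic_apply [CharZero A] (hS : AlgebraicallyStable D S) {a : A}
    (ha : IsAlgebraic (adjoin R S) a) : IsAlgebraic (adjoin R S) (D a) :=
  isAlgebraic_derivation_apply D (fun b => hS.isAlgebraic_apply_of_mem_adjoin b.2) ha

theorem isAlgebraic_iterate_apply [CharZero A] (hS : AlgebraicallyStable D S) {a : A}
    (ha : IsAlgebraic (adjoin R S) a) (k : ℕ) : IsAlgebraic (adjoin R S) (D^[k] a) := by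
  induction k with
  | zero => exact ha
  | succ k ih =>
    rw [Function.iterate_succ_apply']
    exact hS.isAlgebraic_apply ih

end AlgebraicallyStable

theorem exists_algebraicallyStable_image_Iio [IsDomain A] [FaithfulSMul R A] [LinearOrder ι]
    {u : ι → A} (hu : ¬ AlgebraicIndependent R u)
    (hD : ∀ m i, m < i → D (u m) ∈ adjoin R (u '' Iic i)) :
    ∃ i, AlgebraicallyStable D (u '' Iio i) ∧
      ∀ m ≤ i, IsAlgebraic (adjoin R (u '' Iio i)) (u m) := by
  obtain ⟨i, hi⟩ := exists_isAlgebraic_adjoin_image_Iio hu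
  have hle : ∀ m ≤ i, IsAlgebraic (adjoin R (u '' Iio i)) (u m) := fun m hm =>
    hm.lt_or_eq.elim
      (fun hlt => isAlgebraic_adjoin_of_mem (subset_adjoin (mem_image_of_mem u hlt)))
      (fun heq => heq ▸ hi)
  refine ⟨i, ?_, hle⟩
  rintro _ ⟨m, hm, rfl⟩
  refine (isAlgebraic_adjoin_of_mem (hD m i hm)).adjoin_of_forall_isAlgebraic ?_
  rintro _ ⟨⟨l, hl, rfl⟩, -⟩
  exact hle l hl

variable [IsDomain A] [CharZero A] [FaithfulSMul R A]

theorem isDifferentiallyAlgebraic_iff_exists_algebraicallyStable {w : A} :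
    IsDifferentiallyAlgebraic D w ↔
      ∃ S : Set A, S.Finite ∧ AlgebraicallyStable D S ∧ IsAlgebraic (adjoin R S) w := by
  constructor
  · intro hw
    obtain ⟨i, hstable, halg⟩ := exists_algebraicallyStable_image_Iio hw fun m i hm =>
      subset_adjoin ⟨m + 1, hm, Function.iterate_succ_apply' D m w⟩
    exact ⟨_, (finite_Iio i).image _, hstable, halg 0 i.zero_le⟩
  · rintro ⟨S, hfin, hstable, halg⟩
    exact not_algebraicIndependent_of_isAlgebraic_adjoin hfin
      (hstable.isAlgebraic_iterate_apply halg)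

theorem algebraicIndependent_elim_iterate_iff {z w : A} (hz : D z = 1) :
    AlgebraicIndependent R (fun i : Option ℕ => i.elim z fun k => D^[k] w) ↔
      ¬ IsDifferentiallyAlgebraic D w := by
  refine ⟨fun hind hw => hw (hind.comp some (Option.some_injective ℕ)), fun hw => ?_⟩
  contrapose! hw
  -- `WithBot ℕ` is `Option ℕ` with the order that puts `z` in front of the iterates.
  let u : WithBot ℕ → A := fun i => Option.elim i z fun k => D^[k] w
  have hD (m i : WithBot ℕ) (hm : m < i) : D (u m) ∈ adjoin R (u '' Iic i) := by
    induction m with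
    | bot => exact hz ▸ one_mem _
    | coe k =>
      exact subset_adjoin
        ⟨((k + 1 : ℕ) : WithBot ℕ), Order.succ_le_of_lt hm, Function.iterate_succ_apply' D k w⟩
  obtain ⟨i, hstable, halg⟩ := exists_algebraicallyStable_image_Iio (u := u) hw hD
  have hi : i ≠ ⊥ := by
    rintro rfl
    have hzalg := halg ⊥ le_rfl
    rw [Iio_bot, image_empty, adjoin_empty] at hzalg
    exact transcendental_of_derivation_eq_one D hz (Subalgebra.isAlgebraic_of_isAlgebraic_bot hzalg)
  exact isDifferentiallyAlgebraic_iff_exists_algebraicallyStable.2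
    ⟨_, (finite_Iio i).image _, hstable, halg (0 : ℕ) (Order.succ_le_of_lt hi.bot_lt)⟩

namespace IsDifferentiallyAlgebraic

theorem derivation_apply {w : A} (hw : IsDifferentiallyAlgebraic D w) :
    IsDifferentiallyAlgebraic D (D w) := by
  obtain ⟨S, hfin, hstable, halg⟩ := isDifferentiallyAlgebraic_iff_exists_algebraicallyStable.1 hw
  exact isDifferentiallyAlgebraic_iff_exists_algebraicallyStable.2
    ⟨S, hfin, hstable, hstable.isAlgebraic_apply halg⟩

theorem exists_algebraicallyStable {U : Set A} (hU : U.Finite)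
    (hUalg : ∀ u ∈ U, IsDifferentiallyAlgebraic D u) :
    ∃ S : Set A, S.Finite ∧ AlgebraicallyStable D S ∧ ∀ u ∈ U, IsAlgebraic (adjoin R S) u := by
  choose! S hfin hstable halg using fun u hu =>
    isDifferentiallyAlgebraic_iff_exists_algebraicallyStable.1 (hUalg u hu)
  exact ⟨⋃ u ∈ U, S u, hU.biUnion hfin, .biUnion hstable, fun u hu =>
    isAlgebraic_adjoin_mono (subset_biUnion_of_mem hu) (halg u hu)⟩

theorem of_isAlgebraic_adjoin_union {T U : Set A} (hT : T.Finite) (hU : U.Finite)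
    (hUalg : ∀ u ∈ U, IsDifferentiallyAlgebraic D u)
    (hD : ∀ t ∈ T, IsAlgebraic (adjoin R (T ∪ U)) (D t)) {w : A}
    (hw : IsAlgebraic (adjoin R (T ∪ U)) w) : IsDifferentiallyAlgebraic D w := by
  obtain ⟨S, hfin, hstable, hSU⟩ := exists_algebraicallyStable hU hUalg
  have htrans {a : A} (ha : IsAlgebraic (adjoin R (T ∪ U)) a) :
      IsAlgebraic (adjoin R (T ∪ S)) a := by
    refine ha.adjoin_of_forall_isAlgebraic ?_
    rintro b ⟨hT | hU, hb⟩
    · exact absurd (Or.inl hT) hb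
    · exact isAlgebraic_adjoin_mono subset_union_right (hSU b hU)
  refine isDifferentiallyAlgebraic_iff_exists_algebraicallyStable.2
    ⟨T ∪ S, hT.union hfin, ?_, htrans hw⟩
  rintro s (hs | hs)
  · exact htrans (hD s hs)
  · exact isAlgebraic_adjoin_mono subset_union_right (hstable s hs)

end IsDifferentiallyAlgebraic

theorem mainTheorem6_general [Finite ι] (f : ι → MvPolynomial ι R) (φ x : ι → A) (j : ι)
    (hj : ¬ IsDifferentiallyAlgebraic D (φ j))
    (honly : ∀ i, i ≠ j → IsDifferentiallyAlgebraic D (φ i))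
    (hx : ∀ i, D (x i) = MvPolynomial.aeval x (f i) + φ i) :
    ¬ IsDifferentiallyAlgebraic D (x j) := by
  intro hxj
  refine hj ?_
  let U : Set A := insert (D (x j)) (φ '' {j}ᶜ)
  have hUalg : ∀ u ∈ U, IsDifferentiallyAlgebraic D u := by
    rintro _ (rfl | ⟨i, hi, rfl⟩)
    exacts [hxj.derivation_apply, honly i hi]
  have hmemU {u : A} (hu : u ∈ U) : u ∈ adjoin R (range x ∪ U) := subset_adjoin (Or.inr hu)
  have hDxj : D (x j) ∈ adjoin R (range x ∪ U) := hmemU (mem_insert _ _)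
  have hf (i : ι) : MvPolynomial.aeval x (f i) ∈ adjoin R (range x ∪ U) :=
    adjoin_mono subset_union_left (adjoin_range_eq_range_aeval R x ▸ ⟨f i, rfl⟩)
  refine .of_isAlgebraic_adjoin_union (finite_range x) ((toFinite _).insert _) hUalg ?_
    (isAlgebraic_adjoin_of_mem ?_)
  · rintro _ ⟨i, rfl⟩
    refine isAlgebraic_adjoin_of_mem ?_
    obtain rfl | hi := eq_or_ne i j
    · exact hDxj
    · exact hx i ▸ add_mem (hf i) (hmemU (mem_insert_of_mem _ ⟨i, hi, rfl⟩))
  · rw [← sub_eq_iff_eq_add'.2 (hx j)]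
    exact sub_mem hDxj (hf j)

end Differential

section Meromorphic

variable {𝕜 E : Type*} [RCLike 𝕜] [NormedAddCommGroup E] [NormedSpace 𝕜 E]

theorem eventually_codiscrete_ne_zero_of_not_eventuallyEq_zero {f : 𝕜 → E} (hf : Meromorphic f)
    (hne : ¬ f =ᶠ[codiscrete 𝕜] 0) : ∀ᶠ z in codiscrete 𝕜, f z ≠ 0 := by
  have horder : ∃ z, meromorphicOrderAt f z ≠ ⊤ := by
    contrapose! hne
    rw [EventuallyEq, eventually_iff, mem_codiscrete]
    simpa only [disjoint_principal_right, compl_compl] using!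
      fun z => meromorphicOrderAt_eq_top_iff.1 (hne z)
  exact hf.meromorphicOn.eventually_codiscreteWithin_apply_ne_zero fun z _ =>
    hf.exists_meromorphicOrderAt_ne_top_iff_forall.1 horder z

end Meromorphic

namespace MeroSystem

theorem ofFun_mul {f g : ℂ → ℂ} (hf : Meromorphic f) (hg : Meromorphic g) :
    ofFun f hf * ofFun g hg = ofFun (f * g) (hf.mul hg) := rfl

instance negligible_isPrime : negligible.IsPrime where
  ne_top' := by
    rw [Ideal.ne_top_iff_one]
    intro hone
    have : (codiscrete ℂ).NeBot := by
      rw [neBot_iff, ne_eq, ← empty_mem_iff_bot, mem_codiscrete]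
      exact fun h => (NormedField.nhdsNE_neBot (0 : ℂ)).ne (by simpa using h 0)
    have hzero : (1 : ℂ → ℂ) =ᶠ[codiscrete ℂ] 0 := hone
    obtain ⟨_, hz⟩ := hzero.exists
    exact one_ne_zero hz
  mem_or_mem' {f g} hfg := by
    refine or_iff_not_imp_left.2 fun hne => ?_
    filter_upwards [hfg, eventually_codiscrete_ne_zero_of_not_eventuallyEq_zero f.2 hne]
      with z hz hfz
    exact (mul_eq_zero.1 hz).resolve_left hfz

instance : CharZero MeromorphicFunction :=
  charZero_of_injective_algebraMap (algebraMap ℂ MeromorphicFunction).injective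

instance : FaithfulSMul ℂ MeromorphicFunction :=
  (faithfulSMul_iff_algebraMap_injective ℂ MeromorphicFunction).2 (algebraMap ℂ _).injective

/-- The operator `ddz` bundled as a derivation of the algebra of meromorphic functions. -/
noncomputable def ddzDerivation : Derivation ℂ MeromorphicFunction MeromorphicFunction :=
  Derivation.mk' ddz fun v w => by
    obtain ⟨f, hf, rfl⟩ := exists_ofFun v
    obtain ⟨g, hg, rfl⟩ := exists_ofFun w
    rw [ofFun_mul, ddz_ofFun, ddz_ofFun, ddz_ofFun, smul_eq_mul, smul_eq_mul, ofFun_mul,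
      ofFun_mul, ofFun_add, ofFun_eq_iff]
    filter_upwards [eventually_differentiableAt hf, eventually_differentiableAt hg] with z hfz hgz
    rw [deriv_mul hfz hgz, Pi.add_apply, Pi.mul_apply, Pi.mul_apply, mul_comm (deriv f z), add_comm]

theorem ddzDerivation_coordZ : ddzDerivation coordZ = 1 := by
  change ofFun (deriv fun z => z) _ = ofFun 1 (Meromorphic.const 1)
  rw [ofFun_eq_iff, deriv_id'']
  rfl

theorem differentiallyTranscendental_iff {w : MeromorphicFunction} :
    DifferentiallyTranscendental w ↔ ¬ IsDifferentiallyAlgebraic ddzDerivation w := by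
  rw [← algebraicIndependent_elim_iterate_iff ddzDerivation_coordZ, algebraicIndependent_iff,
    DifferentiallyTranscendental]
  simp only [evalADE, Module.End.pow_apply]
  rw [not_exists]
  exact forall_congr' fun P => by rw [not_and, not_imp_comm, not_not]; rfl

end MeroSystem

theorem mainTheorem6 (n : ℕ) (B : Matrix (Fin n) (Fin n) ℂ)
    (φ : Fin n → MeroSystem.MeromorphicFunction) (j : Fin n)
    (hj : MeroSystem.DifferentiallyTranscendental (φ j))
    (honly : ∀ i, i ≠ j → ¬ MeroSystem.DifferentiallyTranscendental (φ i))
    (x : Fin n → MeroSystem.MeromorphicFunction)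
    (hx : MeroSystem.IsSolution MeroSystem.ddz B φ x) :
    MeroSystem.DifferentiallyTranscendental (x j) := by
  rw [MeroSystem.differentiallyTranscendental_iff] at hj ⊢
  simp only [MeroSystem.differentiallyTranscendental_iff, not_not] at honly
  exact mainTheorem6_general (fun i => ∑ k, B i k • .X k) φ x j hj honly fun i => by
    simpa using! hx i
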